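/- Let $(\alpha_l)_{l\ge 0}$ be a sequence of real numbers and let $(\beta_l)_{l\ge 0}$, $(\gamma_l)_{l\ge 0}$, $(\rho_l)_{l\ge 0}$ be sequences of positive real numbers. Let $P_l$, $l\ge 0$, be the real polynomials defined by $P_{-1}=0$, $P_0=1$ and \[ \gamma_{l-1}P_{l-1}(\lambda)+\alpha_lP_l(\lambda)+\beta_lP_{l+1}(\lambda)=\lambda\rho_lP_l(\lambda),\qquad l\ge 0 \] (the value of $\gamma_{-1}$ is irrelevant). Let $q\ge 0$ be an integer, let $\eta\in\mathbb{R}$, and put $\widetilde P_{q+1}=P_{q+1}-\eta P_q$. For a function $f\colon\{0,\dots,q\}\to\mathbb{R}$ let $N(f)$ be the number of $\nu\in\{0,\dots,q\}$ such that either $f(\nu)=0$, or $\nu\ge 1$ and $f(\nu-1)f(\nu)<0$. Let $S^-(f)$ and $S^+(f)$ be, respectively, the least and the largest number of sign changes on $\{0,\dots,q\}$ that can be obtained from $f$ by replacing all its zero values by arbitrary nonzero real values; here the number of sign changes of a nowhere zero function $g$ is the number of $\nu\in\{0,\dots,q-1\}$ with $g(\nu)g(\nu+1)<0$. Then the zeros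 of $\widetilde P_{q+1}$ are $q+1$ distinct real numbers $\lambda_{q+1}<\dots<\lambda_1$. Set $\psi_k(\nu)=P_\nu(\lambda_k)$ for $1\le k\le q+1$ and $0\le\nu\le q$; these are the eigenfunctions, with eigenvalues $\lambda_k$, of the discrete Sturm--Liouville problem \[ \gamma_{\nu-1}\psi(\nu-1)+\alpha_\nu\psi(\nu)+\beta_\nu\psi(\nu+1)=\lambda\rho_\nu\psi(\nu)\quad(0\le\nu\le q),\qquad \psi(-1)=0,\ \psi(0)=1,\ \psi(q+1)=\eta\psi(q). \] Let $m,n$ be integers with $1\le m\le n\le q+1$, and let $V(\nu)=\sum_{k=m}^n a_k\psi_k(\nu)$, where $a_m,\dots,a_n$ are real numbers that are not all zero. Then \[ m-1\le S^-(V)\le N(V)\le S^+(V)\le n-1 . \] -/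

import Mathlib

open Polynomial

namespace DiscreteSturm

/-- The polynomials `P_l`, `l ≥ 0`, defined by `P_{-1} = 0`, `P_0 = 1` and
`γ_{l-1} P_{l-1} + α_l P_l + β_l P_{l+1} = X ρ_l P_l` (solved for `P_{l+1}`). The value of
`γ_{-1}` is irrelevant as `P_{-1} = 0`. -/
noncomputable def P (α β γ ρ : ℕ → ℝ) : ℕ → ℝ[X]
  | 0 => 1
  | 1 => C (β 0)⁻¹ * ((C (ρ 0) * X - C (α 0)) * 1)
  | l + 2 => C (β (l + 1))⁻¹ *
      ((C (ρ (l + 1)) * X - C (α (l + 1))) * P α β γ ρ (l + 1) - C (γ l) * P α β γ ρ l)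

/-- `P̃_{q+1} = P_{q+1} - η P_q`. -/
noncomputable def Ptilde (α β γ ρ : ℕ → ℝ) (η : ℝ) (q : ℕ) : ℝ[X] :=
  P α β γ ρ (q + 1) - C η * P α β γ ρ q

/-- `lam 1 > lam 2 > ⋯ > lam (q+1)` are exactly the zeros of `P̃_{q+1}`.
The values of `lam` outside of `{1, …, q+1}` play no role. -/
def IsZeroEnumeration (α β γ ρ : ℕ → ℝ) (η : ℝ) (q : ℕ) (lam : ℕ → ℝ) : Prop :=
  StrictAntiOn lam (Set.Icc 1 (q + 1)) ∧
    ∀ x : ℝ, (Ptilde α β γ ρ η q).IsRoot x ↔ ∃ k ∈ Set.Icc 1 (q + 1), lam k = x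

/-- `ψ_k(ν) = P_ν(λ_k)`. -/
noncomputable def psi (α β γ ρ : ℕ → ℝ) (lam : ℕ → ℝ) (k ν : ℕ) : ℝ :=
  (P α β γ ρ ν).eval (lam k)

/-- `ψ_k` is an eigenfunction, with eigenvalue `lam k`, of the discrete Sturm–Liouville problem
`γ_{ν-1} ψ(ν-1) + α_ν ψ(ν) + β_ν ψ(ν+1) = λ ρ_ν ψ(ν)`, `0 ≤ ν ≤ q`, with boundary conditions
`ψ(-1) = 0`, `ψ(0) = 1`, `ψ(q+1) = η ψ(q)`. -/
theorem psi_eigenfunction {α β γ ρ : ℕ → ℝ} (hβ : ∀ l, 0 < β l) {η : ℝ} {q : ℕ} {lam : ℕ → ℝ}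
    (h : IsZeroEnumeration α β γ ρ η q lam) {k : ℕ} (hk : k ∈ Set.Icc 1 (q + 1)) :
    (∀ ν, (if ν = 0 then 0 else γ (ν - 1) * psi α β γ ρ lam k (ν - 1)) +
        α ν * psi α β γ ρ lam k ν + β ν * psi α β γ ρ lam k (ν + 1) =
          lam k * ρ ν * psi α β γ ρ lam k ν) ∧
      psi α β γ ρ lam k 0 = 1 ∧ psi α β γ ρ lam k (q + 1) = η * psi α β γ ρ lam k q := by
  refine ⟨fun ν => ?_, by simp [psi, P], ?_⟩
  · have hν := (hβ ν).ne'
    cases ν with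
    | zero => simp [psi, P]; field_simp; ring
    | succ l => simp [psi, P]; field_simp; ring
  · have := (h.2 (lam k)).2 ⟨k, hk, rfl⟩
    simp only [Ptilde, IsRoot, eval_sub, eval_mul, eval_C] at this
    simpa [psi] using sub_eq_zero.1 this

/-! Discrete functions on `{0, …, q}` are given as functions on `ℕ`; the quantities below
only look at their values on `{0, …, q}`. -/

open Classical in
/-- The number `N(f)` of (generalized) zeros of `f` on `{0, …, q}`: points `ν` with `f ν = 0`, or
with `ν ≥ 1` and `f (ν - 1) * f ν < 0`. -/
noncomputable def N (q : ℕ) (f : ℕ → ℝ) : ℕ :=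
  ((Finset.range (q + 1)).filter
    (fun ν => f ν = 0 ∨ (1 ≤ ν ∧ f (ν - 1) * f ν < 0))).card

open Classical in
/-- The number of sign changes on `{0, …, q}` of a function `g` without zeros there. -/
noncomputable def signChanges (q : ℕ) (g : ℕ → ℝ) : ℕ :=
  ((Finset.range q).filter (fun ν => g ν * g (ν + 1) < 0)).card

/-- The possible numbers of sign changes on `{0, …, q}` after all zero values of `f` have been
replaced by arbitrary nonzero values. -/
def signChangeCounts (q : ℕ) (f : ℕ → ℝ) : Set ℕ :=
  {c | ∃ g : ℕ → ℝ, (∀ ν ≤ q, g ν ≠ 0) ∧ (∀ ν ≤ q, f ν ≠ 0 → g ν = f ν) ∧ signChanges q g = c}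

/-- `S⁻(f)`, the least possible number of sign changes. -/
noncomputable def Sminus (q : ℕ) (f : ℕ → ℝ) : ℕ := sInf (signChangeCounts q f)

/-- `S⁺(f)`, the largest possible number of sign changes. -/
noncomputable def Splus (q : ℕ) (f : ℕ → ℝ) : ℕ := sSup (signChangeCounts q f)

theorem signChangeCounts_nonempty (q : ℕ) (f : ℕ → ℝ) : (signChangeCounts q f).Nonempty := by
  classical
  refine ⟨_, fun ν => if f ν = 0 then 1 else f ν, ?_, ?_, rfl⟩
  · intro ν _
    by_cases h : f ν = 0 <;> simp [h]
  · intro ν _ h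
    simp [h]

theorem signChangeCounts_bddAbove (q : ℕ) (f : ℕ → ℝ) : BddAbove (signChangeCounts q f) := by
  refine ⟨q, ?_⟩
  rintro c ⟨g, -, -, rfl⟩
  exact (Finset.card_filter_le _ _).trans (by simp)

/-- The least and the largest numbers are attained, so that `sInf` and `sSup` above are a minimum
and a maximum. -/
theorem isLeast_Sminus (q : ℕ) (f : ℕ → ℝ) : IsLeast (signChangeCounts q f) (Sminus q f) :=
  ⟨Nat.sInf_mem (signChangeCounts_nonempty q f), fun _ h => Nat.sInf_le h⟩

theorem isGreatest_Splus (q : ℕ) (f : ℕ → ℝ) : IsGreatest (signChangeCounts q f) (Splus q f) :=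
  ⟨Nat.sSup_mem (signChangeCounts_nonempty q f) (signChangeCounts_bddAbove q f),
    fun _ h => le_csSup (signChangeCounts_bddAbove q f) h⟩

end DiscreteSturm

/-! The lower bound is a backward-flow argument. After a shift by a large `c`, the Sturm–Liouville
operator is tridiagonal with positive off-diagonals and dominant diagonal. It therefore factors into
a lower and an upper bidiagonal matrix with nonnegative entries, and neither factor can increase the
number of sign alternations (`Alternates.of_tridiagonal`). Its `t`-th power multiplies `a_k` by
`(λ_k + c)^t`, so for large `t` the image of `V` looks like a positive multiple of `a_p ψ_p`, with
`p ≥ m` the first index having `a_p ≠ 0`. The Sturm sequence property gives `ψ_p` at least `p - 1`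
alternations (`IsZeroEnumeration.alternates_psi`). These survive small perturbations, so `V` has at
least `m - 1` of them.

The upper bound is the lower bound for the reflected problem. Multiplication by `(-1)^ν` replaces
`α`, `η`, `λ` by their negatives and so reverses the order of the eigenvalues, which gives `q + 1 -
n ≤ S⁻((-1)^ν V)`. Since `S⁺(f) + S⁻((-1)^ν f) ≤ q` (`Splus_add_Sminus_le`), this yields `S⁺(V) ≤ n
- 1`. The inequalities around `N` hold for every function that is not identically zero. -/

namespace DiscreteSturm

/-! ### Alternations and maps that do not increase them -/

/-- `f` takes values of strictly alternating signs, starting with the sign of `s`, at `k + 1`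
successive points of `{0, …, q}`. -/
def Alternates (q k : ℕ) (s : ℝ) (f : ℕ → ℝ) : Prop :=
  ∃ i : ℕ → ℕ, (∀ j < k, i j < i (j + 1)) ∧ i k ≤ q ∧ ∀ j ≤ k, 0 < s * (-1) ^ j * f (i j)

theorem le_of_forall_lt_succ {i : ℕ → ℕ} {k : ℕ} (hi : ∀ j < k, i j < i (j + 1)) {a b : ℕ}
    (hab : a ≤ b) (hb : b ≤ k) : i a ≤ i b := by
  induction b, hab using Nat.le_induction with
  | base => exact le_rfl
  | succ b _ ih => exact (ih (by omega)).trans (hi b (by omega)).le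

theorem Alternates.mono {q q' k k' : ℕ} {s : ℝ} {f : ℕ → ℝ} (h : Alternates q k s f)
    (hq : q ≤ q') (hk : k' ≤ k) : Alternates q' k' s f := by
  obtain ⟨i, h1, h2, h3⟩ := h
  exact ⟨i, fun j hj => h1 j (by omega), ((le_of_forall_lt_succ h1 hk le_rfl).trans h2).trans hq,
    fun j hj => h3 j (by omega)⟩

theorem Alternates.snoc {q k : ℕ} {s : ℝ} {f : ℕ → ℝ} (h : Alternates q k s f)
    (hf : 0 < s * (-1) ^ (k + 1) * f (q + 1)) : Alternates (q + 1) (k + 1) s f := by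
  obtain ⟨i, h1, h2, h3⟩ := h
  refine ⟨fun j => if j ≤ k then i j else q + 1, fun j hj => ?_, by simp, fun j hj => ?_⟩
  · rcases Nat.lt_or_ge j k with hjk | hjk
    · simpa [hjk.le, Nat.succ_le_of_lt hjk] using h1 j hjk
    · obtain rfl : j = k := by omega
      simpa using Nat.lt_succ_of_le h2
  · rcases Nat.lt_or_ge k j with hjk | hjk
    · obtain rfl : j = k + 1 := by omega
      simpa using hf
    · simpa [hjk] using h3 j hjk

theorem Alternates.exists_ne_zero {q k : ℕ} {s : ℝ} {f : ℕ → ℝ} (h : Alternates q k s f) :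
    ∃ ν ≤ q, f ν ≠ 0 := by
  obtain ⟨i, h1, h2, h3⟩ := h
  refine ⟨i 0, (le_of_forall_lt_succ h1 (Nat.zero_le k) le_rfl).trans h2, fun h0 => ?_⟩
  simpa [h0] using h3 0 (Nat.zero_le k)

/-- A map with banded nonnegative structure does not increase the number of alternations. -/
theorem Alternates.of_band {q k : ℕ} {s : ℝ} {f g : ℕ → ℝ} (lo hi : ℕ → ℕ)
    (hlohi : ∀ ν ν', ν < ν' → hi ν ≤ lo ν') (hq : ∀ ν ≤ q, hi ν ≤ q)
    (hfg : ∀ ν ≤ q, ∀ t : ℝ, 0 < t * g ν → ∃ p, lo ν ≤ p ∧ p ≤ hi ν ∧ 0 < t * f p)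
    (h : Alternates q k s g) : Alternates q k s f := by
  obtain ⟨i, h1, h2, h3⟩ := h
  have hiq : ∀ j ≤ k, i j ≤ q := fun j hj => (le_of_forall_lt_succ h1 hj le_rfl).trans h2
  have hex : ∀ j, ∃ p, j ≤ k → lo (i j) ≤ p ∧ p ≤ hi (i j) ∧ 0 < s * (-1) ^ j * f p := by
    intro j
    by_cases hj : j ≤ k
    · obtain ⟨p, hp⟩ := hfg (i j) (hiq j hj) _ (h3 j hj)
      exact ⟨p, fun _ => hp⟩
    · exact ⟨0, fun h => absurd h hj⟩
  choose p hp using hex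
  refine ⟨p, fun j hj => ?_, (hp k le_rfl).2.1.trans (hq _ h2), fun j hj => (hp j hj).2.2⟩
  -- The bands only give weak monotonicity of the chosen points; equality is excluded because `f`
  -- has opposite signs at consecutive ones.
  refine lt_of_le_of_ne ((hp j hj.le).2.1.trans ((hlohi _ _ (h1 j hj)).trans (hp (j + 1) hj).1))
    fun heq => ?_
  have ha := (hp j hj.le).2.2
  have hb := (hp (j + 1) hj).2.2
  rw [← heq, pow_succ] at hb
  linarith

theorem Alternates.of_lower {q k : ℕ} {s : ℝ} {f g : ℕ → ℝ} (a b : ℕ → ℝ)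
    (ha : ∀ ν ≤ q, 0 ≤ a ν) (hb : ∀ ν ≤ q, 0 ≤ b ν)
    (hg : ∀ ν ≤ q, g ν = a ν * f ν + b ν * f (ν - 1))
    (h : Alternates q k s g) : Alternates q k s f := by
  refine h.of_band (fun ν => ν - 1) id (fun ν ν' h => by simp only [id]; omega) (fun ν h => h) ?_
  intro ν hν t ht
  by_contra! hcon
  have h1 := hcon ν (by omega) le_rfl
  have h2 := hcon (ν - 1) le_rfl (by simp)
  rw [hg ν hν] at ht
  nlinarith [mul_nonneg (ha ν hν) (neg_nonneg.2 h1), mul_nonneg (hb ν hν) (neg_nonneg.2 h2)]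

theorem Alternates.of_upper {q k : ℕ} {s : ℝ} {f g : ℕ → ℝ} (a b : ℕ → ℝ)
    (ha : ∀ ν ≤ q, 0 ≤ a ν) (hb : ∀ ν ≤ q, 0 ≤ b ν) (hf : f (q + 1) = 0)
    (hg : ∀ ν ≤ q, g ν = a ν * f ν + b ν * f (ν + 1))
    (h : Alternates q k s g) : Alternates q k s f := by
  refine h.of_band id (fun ν => min (ν + 1) q) (fun ν ν' h => by simp only [id]; omega)
    (fun ν h => min_le_right _ _) ?_
  intro ν hν t ht
  by_contra! hcon
  have h1 := hcon ν le_rfl (by simp [hν])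
  have h2 : t * f (ν + 1) ≤ 0 := by
    rcases hν.lt_or_eq with hlt | rfl
    · exact hcon (ν + 1) (by simp) (by simp; omega)
    · simp [hf]
  rw [hg ν hν] at ht
  nlinarith [mul_nonneg (ha ν hν) (neg_nonneg.2 h1), mul_nonneg (hb ν hν) (neg_nonneg.2 h2)]

/-! ### Comparison of alternations, `S⁻`, `N` and `S⁺` -/

theorem exists_sign_change {g : ℕ → ℝ} {a b : ℕ} (hab : a ≤ b) (hg : ∀ ν ≤ b, g ν ≠ 0)
    (h : g a * g b < 0) : ∃ ν, a ≤ ν ∧ ν < b ∧ g ν * g (ν + 1) < 0 := by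
  induction b, hab using Nat.le_induction with
  | base => exact absurd h (not_lt.2 (mul_self_nonneg _))
  | succ b hab ih =>
    by_cases hb : g b * g (b + 1) < 0
    · exact ⟨b, hab, Nat.lt_succ_self b, hb⟩
    · have h0 : 0 < g b * g (b + 1) := lt_of_le_of_ne (not_lt.1 hb)
        (mul_ne_zero (hg b (Nat.le_succ b)) (hg _ le_rfl)).symm
      have h1 : g a * g b < 0 := by
        by_contra! h2
        have h3 := mul_nonneg h2 h0.le
        have h4 : 0 < g b ^ 2 := by have := hg b (Nat.le_succ b); positivity
        nlinarith [mul_neg_of_neg_of_pos h h4]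
      obtain ⟨ν, h2, h3, h4⟩ := ih (fun ν hν => hg ν (by omega)) h1
      exact ⟨ν, h2, by omega, h4⟩

theorem Alternates.le_signChanges {q k : ℕ} {s : ℝ} {g : ℕ → ℝ} (hg : ∀ ν ≤ q, g ν ≠ 0)
    (h : Alternates q k s g) : k ≤ signChanges q g := by
  classical
  obtain ⟨i, h1, h2, h3⟩ := h
  have hiq : ∀ j ≤ k, i j ≤ q := fun j hj => (le_of_forall_lt_succ h1 hj le_rfl).trans h2
  have hex : ∀ j, ∃ ν, j < k → i j ≤ ν ∧ ν < i (j + 1) ∧ g ν * g (ν + 1) < 0 := by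
    intro j
    by_cases hj : j < k
    · have hs : g (i j) * g (i (j + 1)) < 0 := by
        have hm := mul_pos (h3 j hj.le) (h3 (j + 1) hj)
        have hsq : 0 < (s * (-1) ^ j) ^ 2 := by
          have : s * (-1) ^ j ≠ 0 := fun h0 => by have := h3 j hj.le; simp [h0] at this
          positivity
        rw [pow_succ] at hm
        by_contra! hcon
        nlinarith [mul_nonneg hsq.le hcon]
      obtain ⟨ν, hν⟩ := exists_sign_change (h1 j hj).le
        (fun ν hν => hg ν (hν.trans (hiq (j + 1) hj))) hs
      exact ⟨ν, fun _ => hν⟩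
    · exact ⟨0, fun h => absurd h hj⟩
  choose p hp using hex
  have hlt : ∀ a b, a < b → b < k → p a < p b := fun a b hab hb =>
    ((hp a (hab.trans hb)).2.1.trans_le
      (le_of_forall_lt_succ h1 (Nat.succ_le_of_lt hab) hb.le)).trans_le (hp b hb).1
  have := Finset.card_le_card_of_injOn (s := Finset.range k)
    (t := (Finset.range q).filter (fun ν => g ν * g (ν + 1) < 0)) p
    (fun j hj => by
      have hj := Finset.mem_range.1 hj
      simp only [Finset.coe_filter, Finset.mem_range, Set.mem_ofPred_eq]
      exact ⟨(hp j hj).2.1.trans_le (hiq _ hj), (hp j hj).2.2⟩)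
    (fun a ha b hb hab => by
      have ha := Finset.mem_range.1 ha
      have hb := Finset.mem_range.1 hb
      rcases lt_trichotomy a b with h | h | h
      · exact absurd hab (hlt a b h hb).ne
      · exact h
      · exact absurd hab (hlt b a h ha).ne')
  simpa [signChanges] using this

/-- Alternation points are not zeros of `f`, so every filling of the zeros keeps them. -/
theorem Alternates.le_Sminus {q k : ℕ} {s : ℝ} {f : ℕ → ℝ} (h : Alternates q k s f) :
    k ≤ Sminus q f := by
  obtain ⟨g, hg, hgf, hc⟩ := (isLeast_Sminus q f).1
  rw [← hc]
  obtain ⟨i, h1, h2, h3⟩ := h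
  refine Alternates.le_signChanges (s := s) hg ⟨i, h1, h2, fun j hj => ?_⟩
  rw [hgf _ ((le_of_forall_lt_succ h1 hj le_rfl).trans h2)
    (fun h0 => by have := h3 j hj; simp [h0] at this)]
  exact h3 j hj

/-- Fill the zeros of `f`, from left to right, with `s` times the previous value. -/
noncomputable def fillZeros (s x : ℝ) (f : ℕ → ℝ) : ℕ → ℝ
  | 0 => open Classical in if f 0 = 0 then x else f 0
  | ν + 1 => open Classical in if f (ν + 1) = 0 then s * fillZeros s x f ν else f (ν + 1)

theorem fillZeros_ne_zero {s x : ℝ} (hs : s ≠ 0) (hx : x ≠ 0) (f : ℕ → ℝ) (ν : ℕ) :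
    fillZeros s x f ν ≠ 0 := by
  induction ν with
  | zero => by_cases h : f 0 = 0 <;> simp [fillZeros, h, hx]
  | succ ν ih => by_cases h : f (ν + 1) = 0 <;> simp [fillZeros, h, hs, ih]

theorem fillZeros_of_ne_zero {s x : ℝ} {f : ℕ → ℝ} {ν : ℕ} (h : f ν ≠ 0) :
    fillZeros s x f ν = f ν := by
  cases ν <;> simp [fillZeros, h]

theorem fillZeros_succ_of_eq_zero {s x : ℝ} {f : ℕ → ℝ} {ν : ℕ} (h : f (ν + 1) = 0) :
    fillZeros s x f (ν + 1) = s * fillZeros s x f ν := by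
  simp [fillZeros, h]

theorem fillZeros_mem {s x : ℝ} (hs : s ≠ 0) (hx : x ≠ 0) (q : ℕ) (f : ℕ → ℝ) :
    signChanges q (fillZeros s x f) ∈ signChangeCounts q f :=
  ⟨_, fun ν _ => fillZeros_ne_zero hs hx f ν, fun _ _ h => fillZeros_of_ne_zero h, rfl⟩

theorem Sminus_le_N (q : ℕ) (f : ℕ → ℝ) : Sminus q f ≤ N q f := by
  classical
  refine ((isLeast_Sminus q f).2 (fillZeros_mem one_ne_zero one_ne_zero q f)).trans ?_
  -- Zeros copy the value on their left, so a sign change never ends at a zero. A change from `ν` to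
  -- `ν + 1` is charged to `ν` if `f ν = 0`, otherwise to `ν + 1`.
  have key : ∀ ν, fillZeros 1 1 f ν * fillZeros 1 1 f (ν + 1) < 0 → f (ν + 1) ≠ 0 := by
    intro ν h h0
    rw [fillZeros_succ_of_eq_zero h0, one_mul] at h
    exact absurd h (not_lt.2 (mul_self_nonneg _))
  refine Finset.card_le_card_of_injOn (fun ν => if f ν = 0 then ν else ν + 1) ?_ ?_
  · intro ν hν
    simp only [Finset.coe_filter, Finset.mem_range, Set.mem_ofPred_eq] at hν ⊢
    by_cases h : f ν = 0
    · simp only [h, if_true]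
      exact ⟨by omega, Or.inl trivial⟩
    · have h2 := hν.2
      rw [fillZeros_of_ne_zero h, fillZeros_of_ne_zero (key ν hν.2)] at h2
      simp only [h, if_false]
      exact ⟨by omega, Or.inr ⟨by omega, h2⟩⟩
  · intro a ha b hb hab
    simp only [Finset.coe_filter, Finset.mem_range, Set.mem_ofPred_eq] at ha hb
    have ka := key a ha.2
    have kb := key b hb.2
    by_cases h1 : f a = 0 <;> by_cases h2 : f b = 0 <;> simp only [h1, h2, if_true, if_false] at hab
    · exact hab
    · exact absurd (hab ▸ h1) kb
    · exact absurd (hab ▸ h2) ka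
    · omega

/-- The zero function must be excluded: it has `N = q + 1` but `S⁺ = q`. -/
theorem N_le_Splus {q : ℕ} {f : ℕ → ℝ} (hf : ∃ ν ≤ q, f ν ≠ 0) : N q f ≤ Splus q f := by
  classical
  have hex : ∃ ν, f ν ≠ 0 := hf.imp fun _ h => h.2
  set r := Nat.find hex with hr
  have hr0 : f r ≠ 0 := Nat.find_spec hex
  have hlt : ∀ ν < r, f ν = 0 := fun ν h => not_not.1 (Nat.find_min hex h)
  have hrq : r ≤ q := by
    obtain ⟨ν, h1, h2⟩ := hf
    exact (Nat.find_min' hex h2).trans h1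
  -- This initial value makes the filling alternate through all leading zeros, up to and including
  -- the first nonzero value `f r`.
  set x : ℝ := (-1) ^ r * f r
  have hx : x ≠ 0 := mul_ne_zero (by simp) hr0
  set g := fillZeros (-1) x f with hg
  have hgne : ∀ ν, g ν ≠ 0 := fillZeros_ne_zero (by norm_num) hx f
  have hgf : ∀ ν, f ν ≠ 0 → g ν = f ν := fun ν h => fillZeros_of_ne_zero h
  have hgs : ∀ ν, f (ν + 1) = 0 → g ν * g (ν + 1) < 0 := fun ν h => by
    rw [hg, fillZeros_succ_of_eq_zero h, ← hg]
    have := mul_self_pos.2 (hgne ν)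
    linarith
  have hgx : ∀ ν ≤ r, g ν = (-1) ^ ν * x := by
    intro ν
    induction ν with
    | zero =>
      intro _
      by_cases h : f 0 = 0
      · simp [hg, fillZeros, h]
      · have h0 : r = 0 := (Nat.find_eq_zero hex).2 h
        simp only [hgf 0 h, x, h0]; simp
    | succ ν ih =>
      intro h
      rcases h.lt_or_eq with h1 | h1
      · rw [hg, fillZeros_succ_of_eq_zero (hlt _ h1), ← hg, ih (by omega), pow_succ]; ring
      · rw [h1, hgf r hr0]
        simp only [x]
        rw [← mul_assoc, ← mul_pow]; norm_num
  refine le_trans ?_ ((isGreatest_Splus q f).2 (fillZeros_mem (s := -1) (by norm_num) hx q f))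
  rw [← hg]
  -- Leading zeros are charged to the change on their right, later generalized zeros to the one on
  -- their left. No collision occurs because `r` itself is not a generalized zero.
  refine Finset.card_le_card_of_injOn (fun ν => if ν < r then ν else ν - 1) ?_ ?_
  · intro ν hν
    simp only [Finset.coe_filter, Finset.mem_range, Set.mem_ofPred_eq] at hν ⊢
    by_cases h : ν < r
    · simp only [h, if_true]
      refine ⟨by omega, ?_⟩
      rw [hgx ν h.le, hgx (ν + 1) h, pow_succ]
      have : 0 < ((-1) ^ ν * x) * ((-1) ^ ν * x) :=
        mul_self_pos.2 (mul_ne_zero (by simp) hx)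
      linarith
    · simp only [h, if_false]
      have hne : ν ≠ 0 := by
        rintro rfl
        rcases hν.2 with h1 | h1
        · exact hr0 (by rwa [show r = 0 by omega])
        · omega
      obtain ⟨μ, rfl⟩ := Nat.exists_eq_succ_of_ne_zero hne
      simp only [Nat.succ_eq_add_one, Nat.add_sub_cancel] at hν ⊢
      refine ⟨by omega, ?_⟩
      rcases hν.2 with h1 | h1
      · exact hgs μ h1
      · have ha : f μ ≠ 0 := fun h0 => by simp [h0] at h1
        have hb : f (μ + 1) ≠ 0 := fun h0 => by simp [h0] at h1
        rw [hgf _ ha, hgf _ hb]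
        exact h1.2
  · have hnr : ∀ ν, (f ν = 0 ∨ 1 ≤ ν ∧ f (ν - 1) * f ν < 0) → ν ≠ r := by
      rintro ν h rfl
      rcases h with h | ⟨h1, h⟩
      · exact hr0 h
      · rw [hlt _ (by omega)] at h; simp at h
    intro a ha b hb hab
    simp only [Finset.coe_filter, Finset.mem_range, Set.mem_ofPred_eq] at ha hb
    have h1 := hnr a ha.2
    have h2 := hnr b hb.2
    simp only at hab
    split_ifs at hab <;> omega

/-- Each of the `q` adjacent pairs is a sign change for exactly one of the two functions. -/
theorem signChanges_add_signChanges_neg_one_pow {q : ℕ} {g : ℕ → ℝ} (hg : ∀ ν ≤ q, g ν ≠ 0) :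
    signChanges q g + signChanges q (fun ν => (-1) ^ ν * g ν) = q := by
  classical
  have h : signChanges q (fun ν => (-1) ^ ν * g ν) =
      ((Finset.range q).filter (fun ν => ¬ g ν * g (ν + 1) < 0)).card := by
    unfold signChanges
    congr 1
    refine Finset.filter_congr fun ν hν => ?_
    have hν := Finset.mem_range.1 hν
    have h0 : g ν * g (ν + 1) ≠ 0 := mul_ne_zero (hg _ hν.le) (hg _ hν)
    have h1 : (-1 : ℝ) ^ ν * g ν * ((-1) ^ (ν + 1) * g (ν + 1)) = -(g ν * g (ν + 1)) := by
      have : (-1 : ℝ) ^ ν * (-1) ^ ν = 1 := by rw [← mul_pow]; norm_num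
      rw [pow_succ]
      linear_combination (-(g ν * g (ν + 1))) * this
    rw [h1, neg_lt_zero, not_lt]
    exact ⟨le_of_lt, fun h => lt_of_le_of_ne h h0.symm⟩
  rw [h, signChanges, Finset.card_filter_add_card_filter_not, Finset.card_range]

theorem Splus_add_Sminus_le (q : ℕ) (f : ℕ → ℝ) :
    Splus q f + Sminus q (fun ν => (-1) ^ ν * f ν) ≤ q := by
  obtain ⟨g, hg, hgf, hc⟩ := (isGreatest_Splus q f).1
  rw [← hc]
  refine le_trans (Nat.add_le_add_left ?_ _) (signChanges_add_signChanges_neg_one_pow hg).le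
  refine (isLeast_Sminus q _).2 ⟨_, fun ν hν => ?_, fun ν hν h => ?_, rfl⟩
  · exact mul_ne_zero (by simp) (hg ν hν)
  · simp only
    rw [hgf ν hν (right_ne_zero_of_mul h)]

/-! ### Real roots of polynomials from sign patterns -/

theorem exists_isRoot_of_mul_neg {p : ℝ[X]} {a b : ℝ} (hab : a < b)
    (h : p.eval a * p.eval b < 0) : ∃ z, a < z ∧ z < b ∧ p.IsRoot z := by
  rcases mul_neg_iff.1 h with h | h
  · obtain ⟨z, hz, h0⟩ := intermediate_value_Ioo' hab.le p.continuous.continuousOn ⟨h.2, h.1⟩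
    exact ⟨z, hz.1, hz.2, h0⟩
  · obtain ⟨z, hz, h0⟩ := intermediate_value_Ioo hab.le p.continuous.continuousOn h
    exact ⟨z, hz.1, hz.2, h0⟩

theorem exists_gt_eval_pos {p : ℝ[X]} {n : ℕ} (hdeg : p.natDegree = n + 1)
    (hlc : 0 < p.leadingCoeff) (b : ℝ) : ∃ M, b < M ∧ 0 < p.eval M := by
  have ht := p.tendsto_atTop_of_leadingCoeff_nonneg
    (natDegree_pos_iff_degree_pos.1 (by omega)) hlc.le
  obtain ⟨M, h1, h2⟩ := ((ht.eventually_gt_atTop 0).and (Filter.eventually_gt_atTop b)).exists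
  exact ⟨M, h2, h1⟩

theorem exists_lt_eval_sign {p : ℝ[X]} {n : ℕ} (hdeg : p.natDegree = n + 1)
    (hlc : 0 < p.leadingCoeff) (b : ℝ) : ∃ M, M < b ∧ 0 < (-1) ^ (n + 1) * p.eval M := by
  have hX : (-X : ℝ[X]).natDegree = 1 := by simp
  have hne : ((-1 : ℝ) ^ (n + 1)) ≠ 0 := by simp
  obtain ⟨M, h1, h2⟩ := exists_gt_eval_pos (p := C ((-1) ^ (n + 1)) * p.comp (-X)) (n := n)
    (by rw [natDegree_C_mul hne, natDegree_comp, hX, hdeg, mul_one])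
    (by
      rw [leadingCoeff_mul, leadingCoeff_C, leadingCoeff_comp (by rw [hX]; exact one_ne_zero), hdeg,
        leadingCoeff_neg, leadingCoeff_X, mul_left_comm, ← mul_pow]
      simpa using hlc) (-b)
  refine ⟨-M, by linarith, ?_⟩
  simpa using h2

theorem eval_eq_prod_of_strictAntiOn {p : ℝ[X]} {n : ℕ} (hdeg : p.natDegree = n)
    (hlc : p.leadingCoeff ≠ 0) {z : ℕ → ℝ} (hz : StrictAntiOn z (Set.Icc 1 n))
    (hroot : ∀ k ∈ Set.Icc 1 n, p.IsRoot (z k)) (x : ℝ) :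
    p.eval x = p.leadingCoeff * ∏ k ∈ Finset.Icc 1 n, (x - z k) := by
  have hp : p ≠ 0 := leadingCoeff_ne_zero.1 hlc
  have hle : (Finset.Icc 1 n).val.map z ≤ p.roots := by
    rw [Multiset.le_iff_subset]
    · intro y hy
      obtain ⟨k, hk, rfl⟩ := Multiset.mem_map.1 hy
      exact (mem_roots hp).2 (hroot k (by simpa using hk))
    · refine Multiset.Nodup.map_on (fun a ha b hb hab => ?_) (Finset.Icc 1 n).nodup
      exact hz.injOn (by simpa using ha) (by simpa using hb) hab
  have hroots : p.roots = (Finset.Icc 1 n).val.map z := by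
    refine (Multiset.eq_of_le_of_card_le hle ?_).symm
    simpa [hdeg] using p.card_roots'
  have h := C_leadingCoeff_mul_prod_multiset_X_sub_C (p := p) (by rw [hroots, hdeg]; simp)
  conv_lhs => rw [← h, hroots]
  rw [Multiset.map_map, eval_mul, eval_C]
  congr 1
  change eval x (∏ k ∈ Finset.Icc 1 n, (X - C (z k))) = _
  rw [eval_prod]
  simp

theorem prod_sub_sign {n k : ℕ} {z : ℕ → ℝ} {x : ℝ} (hk : k ≤ n)
    (h1 : ∀ j ∈ Set.Icc 1 k, x < z j) (h2 : ∀ j ∈ Set.Icc (k + 1) n, z j < x) :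
    0 < (-1) ^ k * ∏ j ∈ Finset.Icc 1 n, (x - z j) := by
  induction n generalizing k with
  | zero => obtain rfl : k = 0 := by omega
            simp
  | succ n ih =>
    rw [Finset.prod_Icc_succ_top (by omega)]
    rcases hk.lt_or_eq with h | rfl
    · have ha := ih (k := k) (by omega) h1 (fun j hj => h2 j ⟨hj.1, hj.2.trans (Nat.le_succ n)⟩)
      have hb := h2 (n + 1) ⟨h, le_rfl⟩
      have := mul_pos ha (sub_pos.2 hb)
      linarith
    · have ha := ih (k := n) le_rfl (fun j hj => h1 j ⟨hj.1, hj.2.trans (Nat.le_succ n)⟩)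
        (fun j hj => by have := hj.1.trans hj.2; omega)
      have hb := h1 (n + 1) ⟨by omega, le_rfl⟩
      have := mul_pos ha (sub_pos.2 hb)
      rw [pow_succ]
      linarith

theorem strictAntiOn_Icc_of_succ_lt {n : ℕ} {z : ℕ → ℝ}
    (h : ∀ k ∈ Set.Icc 1 n, z (k + 1) < z k) : StrictAntiOn z (Set.Icc 1 (n + 1)) := by
  intro a ha b hb hab
  obtain ⟨hb1, hb2⟩ := hb
  clear hb1
  induction b, hab using Nat.le_induction with
  | base => exact h a ⟨ha.1, by omega⟩
  | succ b hab ih => exact (h b ⟨by have := ha.1; omega, by omega⟩).trans (ih (by omega))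

theorem exists_interlacing_roots {p : ℝ[X]} {n : ℕ} (hdeg : p.natDegree = n + 1)
    (hlc : 0 < p.leadingCoeff) {y : ℕ → ℝ} (hy : StrictAntiOn y (Set.Icc 1 n))
    (hs : ∀ k ∈ Set.Icc 1 n, 0 < (-1) ^ k * p.eval (y k)) :
    ∃ z : ℕ → ℝ, (∀ k ∈ Set.Icc 1 n, z (k + 1) < y k ∧ y k < z k) ∧
      ∀ k ∈ Set.Icc 1 (n + 1), p.IsRoot (z k) := by
  obtain ⟨M, hM, hpM⟩ := exists_gt_eval_pos hdeg hlc (y 1)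
  obtain ⟨M', hM', hpM'⟩ := exists_lt_eval_sign hdeg hlc (min M (y n))
  obtain ⟨hM'1, hM'2⟩ := lt_min_iff.1 hM'
  -- Padding the `y k` with one far point on each side gives `n + 2` points of alternating sign,
  -- hence `n + 1` roots between them.
  let w : ℕ → ℝ := fun k => if k = 0 then M else if k ≤ n then y k else M'
  have hw : ∀ k ≤ n, w (k + 1) < w k := by
    intro k hk
    rcases Nat.eq_zero_or_pos k with rfl | hk0
    · rcases Nat.eq_zero_or_pos n with rfl | hn
      · simpa [w] using hM'1
      · simpa [w, Nat.succ_le_of_lt hn] using hM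
    · rcases hk.lt_or_eq with h | rfl
      · simpa [w, hk0.ne', hk, Nat.succ_le_of_lt h] using
          hy ⟨hk0, hk⟩ ⟨by omega, h⟩ (Nat.lt_succ_self k)
      · simpa [w, hk0.ne'] using hM'2
  have hws : ∀ k ≤ n + 1, 0 < (-1) ^ k * p.eval (w k) := by
    intro k hk
    rcases Nat.eq_zero_or_pos k with rfl | hk0
    · simpa [w] using hpM
    · rcases hk.lt_or_eq with h | rfl
      · simpa [w, hk0.ne', Nat.le_of_lt_succ h] using hs k ⟨hk0, by omega⟩
      · simpa [w] using hpM'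
  have hex : ∀ k, ∃ z, k ≤ n → w (k + 1) < z ∧ z < w k ∧ p.IsRoot z := by
    intro k
    by_cases hk : k ≤ n
    · obtain ⟨z, hz⟩ := exists_isRoot_of_mul_neg (p := p) (hw k hk) (by
        have := mul_pos (hws k (by omega)) (hws (k + 1) (by omega))
        have h1 : (-1 : ℝ) ^ k * (-1) ^ k = 1 := by rw [← mul_pow]; norm_num
        rw [pow_succ] at this
        linear_combination this - (eval (w (k + 1)) p * eval (w k) p) * h1)
      exact ⟨z, fun _ => hz⟩
    · exact ⟨0, fun h => absurd h hk⟩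
  choose z hz using hex
  refine ⟨fun k => z (k - 1), fun k hk => ?_, fun k hk => (hz (k - 1) ?_).2.2⟩
  · obtain ⟨h1, h2⟩ := hk
    have hwk : w k = y k := by simp [w, h2, show k ≠ 0 by omega]
    have ha := (hz k h2).2.1
    have hb := (hz (k - 1) (by omega)).1
    rw [Nat.sub_add_cancel h1, hwk] at hb
    rw [hwk] at ha
    exact ⟨by simpa using ha, hb⟩
  · have := hk.2; omega

/-! ### Sturm sequence properties of the polynomials `P` -/

section Recurrence

variable {α β γ ρ : ℕ → ℝ}

theorem P_coeff (hβ : ∀ l, 0 < β l) (hρ : ∀ l, 0 < ρ l) (l : ℕ) :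
    (∀ k, l < k → (P α β γ ρ l).coeff k = 0) ∧ 0 < (P α β γ ρ l).coeff l := by
  induction l using Nat.twoStepInduction with
  | zero => exact ⟨fun k hk => by simp [P, coeff_one, hk.ne'], by simp [P]⟩
  | one =>
    refine ⟨fun k hk => ?_, ?_⟩
    · obtain ⟨k, rfl⟩ := Nat.exists_eq_add_of_lt hk
      have : 1 + k + 1 ≠ 0 := by omega
      simp [P, coeff_C]
    · have := mul_pos (inv_pos.2 (hβ 0)) (hρ 0)
      simpa [P, coeff_X, coeff_C] using this
  | more l ih0 ih1 =>
    have hc : ∀ k, (P α β γ ρ (l + 2)).coeff (k + 1) = (β (l + 1))⁻¹ *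
        (ρ (l + 1) * (P α β γ ρ (l + 1)).coeff k - α (l + 1) * (P α β γ ρ (l + 1)).coeff (k + 1)
          - γ l * (P α β γ ρ l).coeff (k + 1)) := by
      intro k
      simp [P, sub_mul, mul_assoc, coeff_C_mul, coeff_X_mul]
    refine ⟨fun k hk => ?_, ?_⟩
    · obtain ⟨k, rfl⟩ := Nat.exists_eq_succ_of_ne_zero (show k ≠ 0 by omega)
      rw [hc, ih1.1 k (by omega), ih1.1 (k + 1) (by omega), ih0.1 (k + 1) (by omega)]
      ring
    · rw [hc, ih1.1 (l + 1 + 1) (by omega), ih0.1 (l + 1 + 1) (by omega)]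
      have := mul_pos (inv_pos.2 (hβ (l + 1))) (mul_pos (hρ (l + 1)) ih1.2)
      simpa using this

theorem P_natDegree (hβ : ∀ l, 0 < β l) (hρ : ∀ l, 0 < ρ l) (l : ℕ) :
    (P α β γ ρ l).natDegree = l :=
  natDegree_eq_of_le_of_coeff_ne_zero
    (natDegree_le_iff_coeff_eq_zero.2 (P_coeff hβ hρ l).1) (P_coeff hβ hρ l).2.ne'

theorem P_leadingCoeff_pos (hβ : ∀ l, 0 < β l) (hρ : ∀ l, 0 < ρ l) (l : ℕ) :
    0 < (P α β γ ρ l).leadingCoeff := by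
  rw [leadingCoeff, P_natDegree hβ hρ]
  exact (P_coeff hβ hρ l).2

/-- The data on the zeros `y 1 > ⋯ > y l` of `P_l` that propagate from `l` to `l + 1`. -/
structure SturmZeros (α β γ ρ : ℕ → ℝ) (l : ℕ) (y : ℕ → ℝ) : Prop where
  anti : StrictAntiOn y (Set.Icc 1 l)
  root : ∀ k ∈ Set.Icc 1 l, (P α β γ ρ l).IsRoot (y k)
  sign : ∀ k ∈ Set.Icc 1 l, 0 < (-1) ^ k * (P α β γ ρ (l + 1)).eval (y k)
  alternates : ∀ x, ∀ k ≤ l, (k = 0 ∨ x < y k) →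
    Alternates l k 1 (fun ν => (P α β γ ρ ν).eval x)

theorem P_eval_sign (hβ : ∀ l, 0 < β l) (hρ : ∀ l, 0 < ρ l) {l k : ℕ} {z : ℕ → ℝ} {x : ℝ}
    (hz : StrictAntiOn z (Set.Icc 1 l)) (hroot : ∀ k ∈ Set.Icc 1 l, (P α β γ ρ l).IsRoot (z k))
    (hk : k ≤ l) (h1 : k = 0 ∨ x < z k) (h2 : k = l ∨ z (k + 1) < x) :
    0 < (-1) ^ k * (P α β γ ρ l).eval x := by
  have hlc := P_leadingCoeff_pos (α := α) (γ := γ) hβ hρ l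
  rw [eval_eq_prod_of_strictAntiOn (P_natDegree hβ hρ l) hlc.ne' hz hroot, mul_left_comm]
  refine mul_pos hlc (prod_sub_sign hk (fun j hj => ?_) (fun j hj => ?_))
  · rcases h1 with rfl | h1
    · have := hj.1.trans hj.2; omega
    · exact h1.trans_le (hz.antitoneOn ⟨hj.1, hj.2.trans hk⟩ ⟨hj.1.trans hj.2, hk⟩ hj.2)
  · rcases h2 with rfl | h2
    · have := hj.1.trans hj.2; omega
    · exact (hz.antitoneOn ⟨by omega, hj.1.trans hj.2⟩ ⟨by have := hj.1; omega, hj.2⟩ hj.1).trans_lt h2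

theorem SturmZeros.succ (hβ : ∀ l, 0 < β l) (hγ : ∀ l, 0 < γ l) (hρ : ∀ l, 0 < ρ l) {l : ℕ}
    {y : ℕ → ℝ} (hy : SturmZeros α β γ ρ l y) :
    ∃ z, SturmZeros α β γ ρ (l + 1) z ∧ ∀ k ∈ Set.Icc 1 l, y k < z k ∧ z (k + 1) < y k := by
  obtain ⟨z, hzy, hroot⟩ := exists_interlacing_roots (P_natDegree hβ hρ (l + 1))
    (P_leadingCoeff_pos hβ hρ (l + 1)) hy.anti hy.sign
  have hanti : StrictAntiOn z (Set.Icc 1 (l + 1)) :=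
    strictAntiOn_Icc_of_succ_lt fun k hk => (hzy k hk).1.trans (hzy k hk).2
  refine ⟨z, ⟨hanti, hroot, fun k hk => ?_, fun x k hk hx => ?_⟩, fun k hk => (hzy k hk).symm⟩
  · obtain ⟨k, rfl⟩ := Nat.exists_eq_succ_of_ne_zero (show k ≠ 0 by have := hk.1; omega)
    have hkl : k ≤ l := by have := hk.2; omega
    -- Where `P_{l+1}` vanishes, the recurrence makes `P_{l+2}` a negative multiple of `P_l`, whose
    -- sign is known from interlacing.
    have hs := P_eval_sign (x := z (k + 1)) hβ hρ hy.anti hy.root hkl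
      (by
        rcases Nat.eq_zero_or_pos k with h | h
        · exact Or.inl h
        · exact Or.inr (hzy k ⟨h, hkl⟩).1)
      (by
        rcases hkl.lt_or_eq with h | h
        · exact Or.inr (hzy (k + 1) ⟨by omega, h⟩).2
        · exact Or.inl h)
    have h0 : (P α β γ ρ (l + 1)).eval (z (k + 1)) = 0 := hroot _ hk
    have := mul_pos (mul_pos (inv_pos.2 (hβ (l + 1))) (hγ l)) hs
    simp only [P, eval_mul, eval_sub, eval_C, h0, Nat.succ_eq_add_one, pow_succ]
    linarith
  · rcases Nat.eq_zero_or_pos k with rfl | hk0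
    · exact (hy.alternates x 0 (Nat.zero_le l) (Or.inl rfl)).mono (Nat.le_succ l) le_rfl
    have hxz : x < z k := hx.resolve_left (by omega)
    -- In the remaining case `x` lies beyond `z (k + 1)` but below `z k`, so `P_{l+1}` has sign
    -- `(-1)^k` at `x` and supplies the one missing alternation.
    by_cases hc : k ≤ l ∧ x < y k
    · exact (hy.alternates x k hc.1 (Or.inr hc.2)).mono (Nat.le_succ l) le_rfl
    · obtain ⟨k, rfl⟩ := Nat.exists_eq_succ_of_ne_zero hk0.ne'
      refine (hy.alternates x k (by omega) ?_).snoc ?_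
      · rcases Nat.eq_zero_or_pos k with h | h
        · exact Or.inl h
        · exact Or.inr (hxz.trans (hzy k ⟨h, by omega⟩).1)
      · rw [one_mul]
        refine P_eval_sign hβ hρ hanti hroot hk (Or.inr hxz) ?_
        rcases hk.lt_or_eq with h | h
        · exact Or.inr ((hzy (k + 1) ⟨by omega, by omega⟩).1.trans_le
            (not_lt.1 fun h' => hc ⟨by omega, h'⟩))
        · exact Or.inl h

theorem exists_SturmZeros (hβ : ∀ l, 0 < β l) (hγ : ∀ l, 0 < γ l) (hρ : ∀ l, 0 < ρ l) (l : ℕ) :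
    ∃ y, SturmZeros α β γ ρ l y := by
  induction l with
  | zero =>
    refine ⟨0, fun a ha => ?_, fun a ha => ?_, fun a ha => ?_, fun x k hk _ => ?_⟩
    · have := ha.1.trans ha.2; omega
    · have := ha.1.trans ha.2; omega
    · have := ha.1.trans ha.2; omega
    · obtain rfl : k = 0 := by omega
      exact ⟨id, fun j hj => by omega, le_rfl, fun j hj => by
        obtain rfl : j = 0 := by omega
        simp [P]⟩
  | succ l ih =>
    obtain ⟨y, hy⟩ := ih
    obtain ⟨z, hz, -⟩ := hy.succ hβ hγ hρ
    exact ⟨z, hz⟩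

theorem exists_zeros_P (hβ : ∀ l, 0 < β l) (hγ : ∀ l, 0 < γ l) (hρ : ∀ l, 0 < ρ l) (q : ℕ) :
    ∃ z : ℕ → ℝ, StrictAntiOn z (Set.Icc 1 (q + 1)) ∧
      (∀ x, (P α β γ ρ (q + 1)).IsRoot x ↔ ∃ k ∈ Set.Icc 1 (q + 1), z k = x) ∧
      ∀ k ∈ Set.Icc 1 (q + 1), Alternates q (k - 1) 1 (fun ν => (P α β γ ρ ν).eval (z k)) := by
  obtain ⟨y, hy⟩ := exists_SturmZeros (α := α) hβ hγ hρ q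
  obtain ⟨z, hz, hyz⟩ := hy.succ hβ hγ hρ
  refine ⟨z, hz.anti, fun x => ⟨fun hx => ?_, ?_⟩, fun k hk => ?_⟩
  · have hlc := P_leadingCoeff_pos (α := α) (γ := γ) hβ hρ (q + 1)
    rw [IsRoot, eval_eq_prod_of_strictAntiOn (P_natDegree hβ hρ (q + 1)) hlc.ne' hz.anti hz.root,
      mul_eq_zero, or_iff_right hlc.ne', Finset.prod_eq_zero_iff] at hx
    obtain ⟨k, hk, h⟩ := hx
    exact ⟨k, by simpa using hk, (sub_eq_zero.1 h).symm⟩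
  · rintro ⟨k, hk, rfl⟩
    exact hz.root k hk
  · obtain ⟨h1, h2⟩ := hk
    refine hy.alternates _ _ (by omega) ?_
    rcases h1.eq_or_lt with h | h
    · exact Or.inl (by omega)
    · have := (hyz (k - 1) ⟨by omega, by omega⟩).2
      rw [Nat.sub_add_cancel h1] at this
      exact Or.inr this

/-! ### Reduction to the boundary condition `η = 0` -/

theorem Alternates.congr {q k : ℕ} {s : ℝ} {f g : ℕ → ℝ} (hfg : ∀ ν ≤ q, f ν = g ν)
    (h : Alternates q k s f) : Alternates q k s g := by
  obtain ⟨i, h1, h2, h3⟩ := h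
  refine ⟨i, h1, h2, fun j hj => ?_⟩
  rw [← hfg _ ((le_of_forall_lt_succ h1 hj le_rfl).trans h2)]
  exact h3 j hj

theorem P_congr {α' : ℕ → ℝ} (l : ℕ) (h : ∀ j < l, α j = α' j) :
    P α β γ ρ l = P α' β γ ρ l := by
  induction l using Nat.twoStepInduction with
  | zero => simp [P]
  | one => simp [P, h 0 Nat.one_pos]
  | more l ih0 ih1 =>
    simp only [P, ih0 (fun j hj => h j (by omega)), ih1 (fun j hj => h j (by omega)),
      h (l + 1) (by omega)]

/-- The boundary parameter `η` can be absorbed in the last diagonal coefficient. -/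
theorem P_update_succ (hβ : ∀ l, 0 < β l) (η : ℝ) (q : ℕ) :
    P (Function.update α q (α q + β q * η)) β γ ρ (q + 1) = Ptilde α β γ ρ η q := by
  have hne : ∀ j < q, Function.update α q (α q + β q * η) j = α j := fun j hj =>
    Function.update_of_ne hj.ne _ _
  have hC : (C (β q)⁻¹ * C (β q) : ℝ[X]) = 1 := by
    rw [← C_mul, inv_mul_cancel₀ (hβ q).ne', C_1]
  cases q with
  | zero =>
    simp only [P, Ptilde, Function.update_self, C_add, C_mul]
    linear_combination (-C η) * hC
  | succ q =>
    have h1 : P (Function.update α (q + 1) (α (q + 1) + β (q + 1) * η)) β γ ρ (q + 1) =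
      P α β γ ρ (q + 1) := P_congr _ hne
    have h2 : P (Function.update α (q + 1) (α (q + 1) + β (q + 1) * η)) β γ ρ q =
      P α β γ ρ q := P_congr _ fun j hj => hne j (by omega)
    rw [P, h1, h2, Ptilde, P]
    simp only [Function.update_self, C_add, C_mul]
    linear_combination (-C η * P α β γ ρ (q + 1)) * hC

theorem isZeroEnumeration_update_iff (hβ : ∀ l, 0 < β l) {η : ℝ} {q : ℕ} {lam : ℕ → ℝ} :
    IsZeroEnumeration (Function.update α q (α q + β q * η)) β γ ρ 0 q lam ↔
      IsZeroEnumeration α β γ ρ η q lam := by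
  have : Ptilde (Function.update α q (α q + β q * η)) β γ ρ 0 q = Ptilde α β γ ρ η q := by
    rw [← P_update_succ (α := α) hβ η q, Ptilde, C_0, zero_mul, sub_zero]
  rw [IsZeroEnumeration, IsZeroEnumeration, this]

theorem exists_isZeroEnumeration (hβ : ∀ l, 0 < β l) (hγ : ∀ l, 0 < γ l) (hρ : ∀ l, 0 < ρ l)
    (η : ℝ) (q : ℕ) : ∃ lam, IsZeroEnumeration α β γ ρ η q lam := by
  obtain ⟨z, h1, h2, -⟩ := exists_zeros_P (α := Function.update α q (α q + β q * η)) hβ hγ hρ q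
  rw [P_update_succ hβ] at h2
  exact ⟨z, h1, h2⟩

theorem IsZeroEnumeration.alternates_psi (hβ : ∀ l, 0 < β l) (hγ : ∀ l, 0 < γ l)
    (hρ : ∀ l, 0 < ρ l) {q : ℕ} {lam : ℕ → ℝ} (h : IsZeroEnumeration α β γ ρ 0 q lam) {k : ℕ}
    (hk : k ∈ Set.Icc 1 (q + 1)) : Alternates q (k - 1) 1 (psi α β γ ρ lam k) := by
  obtain ⟨z, hz, hroot, halt⟩ := exists_zeros_P (α := α) hβ hγ hρ q
  have hP : Ptilde α β γ ρ 0 q = P α β γ ρ (q + 1) := by simp [Ptilde]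
  have hiff : ∀ x, (∃ k ∈ Set.Icc 1 (q + 1), lam k = x) ↔ ∃ k ∈ Set.Icc 1 (q + 1), z k = x :=
    fun x => by rw [← h.2, hP, hroot]
  have hex : ∀ j, ∃ i, j ∈ Set.Icc 1 (q + 1) → i ∈ Set.Icc 1 (q + 1) ∧ z i = lam j := by
    intro j
    by_cases hj : j ∈ Set.Icc 1 (q + 1)
    · obtain ⟨i, hi⟩ := (hiff (lam j)).1 ⟨j, hj, rfl⟩
      exact ⟨i, fun _ => hi⟩
    · exact ⟨0, fun h => absurd h hj⟩
  choose σ hσ using hex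
  have hsub : ∀ j ∈ Finset.Icc 1 k, j ∈ Set.Icc 1 (q + 1) := fun j hj => by
    have := Finset.mem_Icc.1 hj
    exact ⟨this.1, this.2.trans hk.2⟩
  -- `σ` injects `{1, …, k}` into `{1, …, σ k}`, so `k ≤ σ k`; this inequality is all that is needed
  -- to compare the two enumerations.
  have hcard := Finset.card_le_card_of_injOn (s := Finset.Icc 1 k) (t := Finset.Icc 1 (σ k)) σ
    (fun j hj => by
      have hj' := hsub j hj
      refine Finset.mem_coe.2 (Finset.mem_Icc.2 ⟨(hσ j hj').1.1, ?_⟩)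
      refine (hz.le_iff_ge (hσ k hk).1 (hσ j hj').1).1 ?_
      rw [(hσ k hk).2, (hσ j hj').2]
      exact h.1.antitoneOn hj' hk (Finset.mem_Icc.1 hj).2)
    (fun a ha b hb hab => by
      refine h.1.injOn (hsub a ha) (hsub b hb) ?_
      rw [← (hσ a (hsub a ha)).2, ← (hσ b (hsub b hb)).2, hab])
  simp only [Nat.card_Icc, Nat.add_sub_cancel] at hcard
  have := (halt (σ k) (hσ k hk).1).mono le_rfl (k' := k - 1) (by omega)
  rw [(hσ k hk).2] at this
  exact this

/-! ### Bidiagonal factorization of the shifted operator -/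

/-- The pivots in the factorization of the tridiagonal operator, shifted by `c`, into a lower and
an upper bidiagonal one. -/
noncomputable def pivot (α β γ ρ : ℕ → ℝ) (c : ℝ) : ℕ → ℝ
  | 0 => α 0 + c * ρ 0
  | ν + 1 => α (ν + 1) + c * ρ (ν + 1) - γ ν * β ν / pivot α β γ ρ c ν

theorem one_le_pivot (hβ : ∀ l, 0 < β l) (hγ : ∀ l, 0 < γ l) {c : ℝ} {q : ℕ}
    (hc : ∀ ν ≤ q, 1 + γ (ν - 1) * β (ν - 1) ≤ α ν + c * ρ ν) :
    ∀ ν ≤ q, 1 ≤ pivot α β γ ρ c ν := by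
  intro ν
  induction ν with
  | zero =>
    intro h
    have := hc 0 h
    have := mul_pos (hγ (0 - 1)) (hβ (0 - 1))
    rw [pivot]; linarith
  | succ ν ih =>
    intro h
    have h1 := hc (ν + 1) h
    have h2 := ih (by omega)
    have h3 : γ ν * β ν / pivot α β γ ρ c ν ≤ γ ν * β ν :=
      div_le_self (mul_pos (hγ ν) (hβ ν)).le h2
    rw [Nat.add_sub_cancel] at h1
    rw [pivot]; linarith

/-- A tridiagonal operator with positive off-diagonals and dominant diagonal does not increase the
number of alternations. -/
theorem Alternates.of_tridiagonal (hβ : ∀ l, 0 < β l) (hγ : ∀ l, 0 < γ l) (hρ : ∀ l, 0 < ρ l)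
    {c : ℝ} {q : ℕ} (hc : ∀ ν ≤ q, 1 + γ (ν - 1) * β (ν - 1) ≤ α ν + c * ρ ν) {f g : ℕ → ℝ}
    (hf : f (q + 1) = 0)
    (hg : ∀ ν ≤ q, ρ ν * g ν = (if ν = 0 then 0 else γ (ν - 1) * f (ν - 1)) +
      (α ν + c * ρ ν) * f ν + β ν * f (ν + 1)) {k : ℕ} {s : ℝ}
    (h : Alternates q k s g) : Alternates q k s f := by
  have hd : ∀ ν ≤ q, 0 < pivot α β γ ρ c ν := fun ν hν =>
    one_pos.trans_le (one_le_pivot hβ hγ hc ν hν)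
  -- The upper factor has unit diagonal; the lower one carries the pivots and the weights `1 / ρ`.
  refine Alternates.of_upper (fun _ => 1) (fun ν => β ν / pivot α β γ ρ c ν)
    (fun _ _ => zero_le_one) (fun ν hν => (div_pos (hβ ν) (hd ν hν)).le) hf (fun _ _ => rfl) ?_
  refine h.of_lower (fun ν => pivot α β γ ρ c ν / ρ ν)
    (fun ν => if ν = 0 then 0 else γ (ν - 1) / ρ ν)
    (fun ν hν => (div_pos (hd ν hν) (hρ ν)).le) (fun ν hν => ?_) (fun ν hν => ?_)
  · split_ifs
    · exact le_rfl
    · exact (div_pos (hγ _) (hρ ν)).le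
  · have hr := (hρ ν).ne'
    have h1 := hg ν hν
    have h2 := (hd ν hν).ne'
    refine mul_left_cancel₀ hr ?_
    rw [h1]
    cases ν with
    | zero =>
      simp only [if_true]
      rw [pivot] at h2 ⊢
      field_simp
      ring
    | succ ν =>
      have h3 := (hd ν (by omega)).ne'
      have h4 : pivot α β γ ρ c (ν + 1) =
        α (ν + 1) + c * ρ (ν + 1) - γ ν * β ν / pivot α β γ ρ c ν := rfl
      have h5 : α (ν + 1) + c * ρ (ν + 1) =
        pivot α β γ ρ c (ν + 1) + γ ν * β ν / pivot α β γ ρ c ν := by rw [h4]; ring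
      simp only [Nat.succ_ne_zero, if_false, Nat.add_sub_cancel, h5]
      field_simp
      ring

/-! ### Power iteration and the lower bound -/

theorem exists_shift (hρ : ∀ l, 0 < ρ l) (q : ℕ) (lam : ℕ → ℝ) :
    ∃ c : ℝ, (∀ ν ≤ q, 1 + γ (ν - 1) * β (ν - 1) ≤ α ν + c * ρ ν) ∧
      ∀ k ≤ q + 1, 0 < lam k + c := by
  have h1 : ∀ᶠ c : ℝ in Filter.atTop, ∀ ν ∈ Finset.range (q + 1),
      (1 + γ (ν - 1) * β (ν - 1) - α ν) / ρ ν ≤ c :=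
    (Filter.eventually_all_finset _).2 fun ν _ => Filter.eventually_ge_atTop _
  have h2 : ∀ᶠ c : ℝ in Filter.atTop, ∀ k ∈ Finset.range (q + 2), -lam k < c :=
    (Filter.eventually_all_finset _).2 fun k _ => Filter.eventually_gt_atTop _
  obtain ⟨c, h1, h2⟩ := (h1.and h2).exists
  refine ⟨c, fun ν hν => ?_, fun k hk => ?_⟩
  · have := (div_le_iff₀ (hρ ν)).1 (h1 ν (Finset.mem_range.2 (by omega)))
    linarith
  · have := h2 k (Finset.mem_range.2 (by omega))
    linarith

theorem alternates_sum_psi_of_eta_eq_zero (hβ : ∀ l, 0 < β l) (hγ : ∀ l, 0 < γ l)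
    (hρ : ∀ l, 0 < ρ l) {q : ℕ} {lam : ℕ → ℝ} (h : IsZeroEnumeration α β γ ρ 0 q lam) {m n : ℕ}
    (hm : 1 ≤ m) (hn : n ≤ q + 1) {a : ℕ → ℝ} (ha : ∃ k ∈ Finset.Icc m n, a k ≠ 0) :
    ∃ s, Alternates q (m - 1) s (fun ν => ∑ k ∈ Finset.Icc m n, a k * psi α β γ ρ lam k ν) := by
  classical
  obtain ⟨c, hc, hlam⟩ := exists_shift (α := α) (β := β) (γ := γ) hρ q lam
  -- The eigenvalues decrease with the index, so the first nonzero coefficient belongs to the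
  -- dominant eigenvalue.
  set p := Nat.find ha with hp
  obtain ⟨hpmn, hap⟩ : p ∈ Finset.Icc m n ∧ a p ≠ 0 := Nat.find_spec ha
  have hmin : ∀ k ∈ Finset.Icc m n, k < p → a k = 0 := fun k hk hkp => by
    by_contra hne
    exact Nat.find_min ha hkp ⟨hk, hne⟩
  have hmem : ∀ k ∈ Finset.Icc m n, k ∈ Set.Icc 1 (q + 1) := fun k hk => by
    have := Finset.mem_Icc.1 hk
    exact ⟨hm.trans this.1, this.2.trans hn⟩
  let W : ℕ → ℕ → ℝ := fun t ν => ∑ k ∈ Finset.Icc m n,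
    a k * (lam k + c) ^ t * psi α β γ ρ lam k ν
  have hstep : ∀ t s j, Alternates q j s (W t) → Alternates q j s (W 0) := by
    intro t s j
    induction t with
    | zero => exact id
    | succ t ih =>
      refine fun hA => ih (Alternates.of_tridiagonal hβ hγ hρ hc ?_ (fun ν _ => ?_) hA)
      -- Here `η = 0` is essential: it makes every `ψ_k` vanish at `q + 1`.
      · refine Finset.sum_eq_zero fun k hk => ?_
        rw [(psi_eigenfunction hβ h (hmem k hk)).2.2]; simp
      · have hif : (if ν = 0 then 0 else γ (ν - 1) * W t (ν - 1)) = ∑ k ∈ Finset.Icc m n,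
            a k * (lam k + c) ^ t *
              (if ν = 0 then 0 else γ (ν - 1) * psi α β γ ρ lam k (ν - 1)) := by
          split_ifs
          · simp
          · simp only [W, Finset.mul_sum]
            exact Finset.sum_congr rfl fun k _ => by ring
        rw [hif]
        simp only [W, Finset.mul_sum]
        rw [← Finset.sum_add_distrib, ← Finset.sum_add_distrib]
        refine Finset.sum_congr rfl fun k hk => ?_
        have := (psi_eigenfunction hβ h (hmem k hk)).1 ν
        rw [pow_succ]
        linear_combination (-(a k * (lam k + c) ^ t)) * this
  have hμ : 0 < lam p + c := hlam p (hmem p hpmn).2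
  have hlim : ∀ ν, Filter.Tendsto (fun t => W t ν / (lam p + c) ^ t) Filter.atTop
      (nhds (a p * psi α β γ ρ lam p ν)) := by
    intro ν
    have hrw : (fun t => W t ν / (lam p + c) ^ t) = fun t => ∑ k ∈ Finset.Icc m n,
        a k * ((lam k + c) / (lam p + c)) ^ t * psi α β γ ρ lam k ν := by
      funext t
      simp only [W, Finset.sum_div, div_pow]
      exact Finset.sum_congr rfl fun k _ => by ring
    have hsum : a p * psi α β γ ρ lam p ν = ∑ k ∈ Finset.Icc m n,
        if k = p then a p * psi α β γ ρ lam p ν else 0 := by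
      rw [Finset.sum_ite_eq' (Finset.Icc m n) p, if_pos hpmn]
    rw [hrw, hsum]
    refine tendsto_finsetSum _ fun k hk => ?_
    rcases lt_trichotomy k p with hkp | rfl | hkp
    · simp [hmin k hk hkp, hkp.ne]
    · simp [div_self hμ.ne']
    · have h1 : lam k + c < lam p + c := by
        linarith [h.1 (hmem p hpmn) (hmem k hk) hkp]
      have := tendsto_pow_atTop_nhds_zero_of_lt_one
        (div_pos (hlam k (hmem k hk).2) hμ).le ((div_lt_one hμ).2 h1)
      simpa [hkp.ne'] using (this.const_mul (a k)).mul_const (psi α β γ ρ lam k ν)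
  obtain ⟨i, h1, h2, h3⟩ := (h.alternates_psi hβ hγ hρ (hmem p hpmn)).mono le_rfl
    (k' := m - 1) (Nat.sub_le_sub_right (Finset.mem_Icc.1 hpmn).1 1)
  have hev : ∀ᶠ t in Filter.atTop, ∀ j ∈ Finset.range (m - 1 + 1),
      0 < a p * (-1) ^ j * (W t (i j) / (lam p + c) ^ t) := by
    refine (Filter.eventually_all_finset _).2 fun j hj => ?_
    have hpos : 0 < a p * (-1) ^ j * (a p * psi α β γ ρ lam p (i j)) := by
      have := mul_pos (mul_self_pos.2 hap) (h3 j (Nat.lt_succ_iff.1 (Finset.mem_range.1 hj)))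
      linarith
    exact ((hlim (i j)).const_mul _).eventually_const_lt hpos
  obtain ⟨t, ht⟩ := hev.exists
  refine ⟨a p, ?_⟩
  have hW0 : W 0 = fun ν => ∑ k ∈ Finset.Icc m n, a k * psi α β γ ρ lam k ν := by
    funext ν; simp [W]
  rw [← hW0]
  refine hstep t _ _ ⟨i, h1, h2, fun j hj => ?_⟩
  have := ht j (Finset.mem_range.2 (Nat.lt_succ_of_le hj))
  rw [← mul_div_assoc] at this
  exact (div_pos_iff_of_pos_right (pow_pos hμ t)).1 this

theorem alternates_sum_psi (hβ : ∀ l, 0 < β l) (hγ : ∀ l, 0 < γ l)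
    (hρ : ∀ l, 0 < ρ l) {q : ℕ} {η : ℝ} {lam : ℕ → ℝ} (h : IsZeroEnumeration α β γ ρ η q lam)
    {m n : ℕ} (hm : 1 ≤ m) (hn : n ≤ q + 1) {a : ℕ → ℝ} (ha : ∃ k ∈ Finset.Icc m n, a k ≠ 0) :
    ∃ s, Alternates q (m - 1) s (fun ν => ∑ k ∈ Finset.Icc m n, a k * psi α β γ ρ lam k ν) := by
  obtain ⟨s, hs⟩ := alternates_sum_psi_of_eta_eq_zero hβ hγ hρ
    ((isZeroEnumeration_update_iff hβ).2 h) hm hn ha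
  refine ⟨s, hs.congr fun ν hν => Finset.sum_congr rfl fun k _ => ?_⟩
  rw [psi, psi, P_congr ν fun j hj => Function.update_of_ne (by omega) _ _]

/-! ### Reflection `ψ(ν) ↦ (-1)^ν ψ(ν)` and the upper bound -/

theorem P_neg_eval (l : ℕ) (x : ℝ) :
    (P (-α) β γ ρ l).eval x = (-1) ^ l * (P α β γ ρ l).eval (-x) := by
  induction l using Nat.twoStepInduction with
  | zero => simp [P]
  | one => simp [P]; ring
  | more l ih0 ih1 =>
    simp only [P, eval_mul, eval_sub, eval_C, eval_X, ih0, ih1, Pi.neg_apply, pow_succ]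
    ring

theorem IsZeroEnumeration.neg {q : ℕ} {η : ℝ} {lam : ℕ → ℝ}
    (h : IsZeroEnumeration α β γ ρ η q lam) :
    IsZeroEnumeration (-α) β γ ρ (-η) q (fun k => -lam (q + 2 - k)) := by
  have hmem : ∀ k ∈ Set.Icc 1 (q + 1), q + 2 - k ∈ Set.Icc 1 (q + 1) := fun k hk => by
    obtain ⟨h1, h2⟩ := hk
    exact ⟨by omega, by omega⟩
  refine ⟨fun a ha b hb hab => neg_lt_neg (h.1 (hmem b hb) (hmem a ha) ?_), fun x => ?_⟩
  · have := hb.2; omega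
  · have heq : (Ptilde (-α) β γ ρ (-η) q).eval x =
        (-1) ^ (q + 1) * (Ptilde α β γ ρ η q).eval (-x) := by
      simp only [Ptilde, eval_sub, eval_mul, eval_C, P_neg_eval, pow_succ]
      ring
    have hiff : (Ptilde (-α) β γ ρ (-η) q).IsRoot x ↔ (Ptilde α β γ ρ η q).IsRoot (-x) := by
      rw [IsRoot, IsRoot, heq]; simp
    rw [hiff, h.2]
    constructor
    · rintro ⟨k, hk, hx⟩
      refine ⟨q + 2 - k, hmem k hk, ?_⟩
      simp only
      rw [show q + 2 - (q + 2 - k) = k by have := hk.2; omega, hx, neg_neg]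
    · rintro ⟨k, hk, hx⟩
      exact ⟨q + 2 - k, hmem k hk, by rw [← hx, neg_neg]⟩

/-- In the reflected problem the index `k` becomes `q + 2 - k`, so the lowest index occurring is `q
+ 2 - n`. -/
theorem alternates_neg_one_pow_sum_psi (hβ : ∀ l, 0 < β l) (hγ : ∀ l, 0 < γ l)
    (hρ : ∀ l, 0 < ρ l) {q : ℕ} {η : ℝ} {lam : ℕ → ℝ} (h : IsZeroEnumeration α β γ ρ η q lam)
    {m n : ℕ} (hm : 1 ≤ m) (hn : n ≤ q + 1) {a : ℕ → ℝ} (ha : ∃ k ∈ Finset.Icc m n, a k ≠ 0) :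
    ∃ s, Alternates q (q + 1 - n) s
      (fun ν => (-1) ^ ν * ∑ k ∈ Finset.Icc m n, a k * psi α β γ ρ lam k ν) := by
  obtain ⟨k₀, hk₀, hak₀⟩ := ha
  have hk₀' := Finset.mem_Icc.1 hk₀
  obtain ⟨s, hs⟩ := alternates_sum_psi hβ hγ hρ h.neg (m := q + 2 - n) (n := q + 2 - m)
    (a := fun k => a (q + 2 - k)) (by omega) (by omega)
    ⟨q + 2 - k₀, Finset.mem_Icc.2 ⟨by omega, by omega⟩, by
      rwa [show q + 2 - (q + 2 - k₀) = k₀ by omega]⟩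
  rw [show q + 2 - n - 1 = q + 1 - n by omega] at hs
  refine ⟨s, hs.congr fun ν _ => ?_⟩
  rw [Finset.mul_sum]
  refine Finset.sum_nbij' (fun k => q + 2 - k) (fun k => q + 2 - k) ?_ ?_ ?_ ?_ ?_
  · intro k hk
    rw [Finset.mem_Icc] at hk ⊢
    omega
  · intro k hk
    rw [Finset.mem_Icc] at hk ⊢
    omega
  · intro k hk
    rw [Finset.mem_Icc] at hk
    omega
  · intro k hk
    rw [Finset.mem_Icc] at hk
    omega
  · intro k _
    simp only [psi, P_neg_eval, neg_neg]
    ring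

end Recurrence

end DiscreteSturm

theorem mainTheorem2 (α β γ ρ : ℕ → ℝ)
    (hβ : ∀ l, 0 < β l) (hγ : ∀ l, 0 < γ l) (hρ : ∀ l, 0 < ρ l) (q : ℕ) (η : ℝ) :
    (∃ lam : ℕ → ℝ, DiscreteSturm.IsZeroEnumeration α β γ ρ η q lam) ∧
    ∀ lam : ℕ → ℝ, DiscreteSturm.IsZeroEnumeration α β γ ρ η q lam →
      ∀ m n : ℕ, 1 ≤ m → m ≤ n → n ≤ q + 1 →
      ∀ a : ℕ → ℝ, (∃ k ∈ Finset.Icc m n, a k ≠ 0) →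
      ∀ V : ℕ → ℝ, (∀ ν, V ν = ∑ k ∈ Finset.Icc m n, a k * DiscreteSturm.psi α β γ ρ lam k ν) →
        m - 1 ≤ DiscreteSturm.Sminus q V ∧
        DiscreteSturm.Sminus q V ≤ DiscreteSturm.N q V ∧
        DiscreteSturm.N q V ≤ DiscreteSturm.Splus q V ∧
        DiscreteSturm.Splus q V ≤ n - 1 := by
  refine ⟨DiscreteSturm.exists_isZeroEnumeration hβ hγ hρ η q, ?_⟩
  intro lam h m n hm _ hn a ha V hV
  obtain rfl : V = _ := funext hV
  obtain ⟨s, hs⟩ := DiscreteSturm.alternates_sum_psi hβ hγ hρ h hm hn ha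
  obtain ⟨s', hs'⟩ := DiscreteSturm.alternates_neg_one_pow_sum_psi hβ hγ hρ h hm hn ha
  refine ⟨hs.le_Sminus, DiscreteSturm.Sminus_le_N q _,
    DiscreteSturm.N_le_Splus hs.exists_ne_zero, ?_⟩
  have h1 := hs'.le_Sminus
  have h2 := DiscreteSturm.Splus_add_Sminus_le q
    (fun ν => ∑ k ∈ Finset.Icc m n, a k * DiscreteSturm.psi α β γ ρ lam k ν)
  omega
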